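/- Let $N\in\mathbb N$ and let either $(\mathfrak L,G)=(\mathfrak u(N),\mathbf U(N))$ or $(\mathfrak L,G)=(\mathfrak{su}(N),\mathbf{SU}(N))$, where $\mathfrak u(N)$ is the real Lie algebra of skew-Hermitian $N\times N$ complex matrices and $\mathfrak{su}(N)$ its subalgebra of traceless matrices. A pair $s=(A,B)\in i\mathfrak L\times i\mathfrak L$ is identified with the control system $i\,\dot U_f(t)=(A+f(t)B)\,U_f(t)$, $U_f(0)=I$; we say that $s$ reaches $g\in G$ in time $T>0$ if there is a real-valued control $f\in L^2(0,T)$ whose (Carathéodory) solution satisfies $U_f(T)=g$. Let $(H_0,H_1)\in i\mathfrak L\times i\mathfrak L$. (1) If the set of all commutator expressions (iterated brackets with at least one commutator) in $iH_0$ and $iH_1$, joined with $iH_0$ and $iH_1$, spans $\mathfrak L$ over $\mathbb R$ (Lie algebra rank condition), then there exist a time $T_{\max}>0$ and a neighborhood $\mathcal N$ of $(H_0,H_1)$ in $i\mathfrak L\times i\mathfrak L$ such that every $s\in\mathcal N$ reaches every $g\in G$ in some time $T<T_{\max}$ (where $T$ may depend on $s$ and $g$). (2) If the set of all commutator expressions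 in $iH_0$ and $iH_1$, joined with $iH_1$ only, spans $\mathfrak L$ over $\mathbb R$ (exact-time Lie algebra rank condition), then there exist a critical time $T_c\ge 0$ and a neighborhood $\mathcal N$ of $(H_0,H_1)$ in $i\mathfrak L\times i\mathfrak L$ such that every $s\in\mathcal N$ reaches every $g\in G$ in time exactly $T$, for every $T>T_c$. -/

import Mathlib

open Matrix MeasureTheory Topology

attribute [local instance] LieRing.ofAssociativeRing

noncomputable section

/-- The real Lie algebra `𝔲(N)` of skew-Hermitian `N × N` matrices, with the commutator bracket. -/
def uLie (N : ℕ) : LieSubalgebra ℝ (Matrix (Fin N) (Fin N) ℂ) where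
  carrier := {A | Aᴴ = -A}
  add_mem' := by
    intro A B hA hB
    simp only [Set.mem_ofPred_eq] at *
    rw [conjTranspose_add, hA, hB, neg_add]
  zero_mem' := by simp
  smul_mem' := by
    intro c A hA
    simp only [Set.mem_ofPred_eq] at *
    rw [conjTranspose_smul, hA, star_trivial, smul_neg]
  lie_mem' := by
    intro A B hA hB
    change Aᴴ = -A at hA
    change Bᴴ = -B at hB
    change ⁅A, B⁆ᴴ = -⁅A, B⁆
    rw [Ring.lie_def, conjTranspose_sub, conjTranspose_mul, conjTranspose_mul, hA, hB]
    noncomm_ring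

/-- The real Lie algebra `𝔰𝔲(N)` of traceless skew-Hermitian `N × N` matrices. -/
def suLie (N : ℕ) : LieSubalgebra ℝ (Matrix (Fin N) (Fin N) ℂ) where
  carrier := {A | A ∈ uLie N ∧ A.trace = 0}
  add_mem' := by
    rintro A B ⟨hA, hA'⟩ ⟨hB, hB'⟩
    exact ⟨add_mem hA hB, by rw [trace_add, hA', hB', add_zero]⟩
  zero_mem' := ⟨zero_mem _, by simp⟩
  smul_mem' := by
    rintro c A ⟨hA, hA'⟩
    exact ⟨(uLie N).smul_mem c hA, by rw [trace_smul, hA', smul_zero]⟩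
  lie_mem' := by
    rintro A B ⟨hA, _⟩ ⟨hB, _⟩
    exact ⟨(uLie N).lie_mem hA hB, by
      rw [Ring.lie_def, trace_sub, trace_mul_comm, sub_self]⟩

/-- The real vector space `i𝔏` of Hamiltonians `H` with `iH ∈ 𝔏`
(as `𝔏` is a real subspace, this is the same as `{iA | A ∈ 𝔏}`). -/
def hamiltonians {N : ℕ} (L : LieSubalgebra ℝ (Matrix (Fin N) (Fin N) ℂ)) :
    Submodule ℝ (Matrix (Fin N) (Fin N) ℂ) where
  carrier := {H | Complex.I • H ∈ L}
  add_mem' := by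
    intro A B hA hB
    simp only [Set.mem_ofPred_eq] at *
    rw [smul_add]
    exact add_mem hA hB
  zero_mem' := by simp
  smul_mem' := by
    intro c A hA
    simp only [Set.mem_ofPred_eq] at *
    rw [smul_comm]
    exact L.smul_mem c hA

/-- Lie words: the letters `A`, `B`, and all iterated brackets of them. -/
inductive IsLieWord {M : Type*} [Bracket M M] (A B : M) : M → Prop
  | left : IsLieWord A B A
  | right : IsLieWord A B B
  | bracket {X Y : M} : IsLieWord A B X → IsLieWord A B Y → IsLieWord A B ⁅X, Y⁆

/-- The set of all commutator expressions in `A` and `B` (with at least one commutator). -/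
def commutatorExpressions {M : Type*} [Bracket M M] (A B : M) : Set M :=
  {Z | ∃ X Y, IsLieWord A B X ∧ IsLieWord A B Y ∧ Z = ⁅X, Y⁆}

/-- Lie algebra rank condition: the commutator expressions in `iH₀`, `iH₁`, joined with
`iH₀` and `iH₁`, span `𝔏` over `ℝ`. -/
def LieRankCondition {N : ℕ} (L : LieSubalgebra ℝ (Matrix (Fin N) (Fin N) ℂ))
    (H₀ H₁ : Matrix (Fin N) (Fin N) ℂ) : Prop :=
  Submodule.span ℝ (commutatorExpressions (Complex.I • H₀) (Complex.I • H₁) ∪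
    {Complex.I • H₀, Complex.I • H₁}) = L.toSubmodule

/-- Exact-time Lie algebra rank condition: the commutator expressions in `iH₀`, `iH₁`, joined with
`iH₁` only, span `𝔏` over `ℝ`. -/
def ExactTimeLieRankCondition {N : ℕ} (L : LieSubalgebra ℝ (Matrix (Fin N) (Fin N) ℂ))
    (H₀ H₁ : Matrix (Fin N) (Fin N) ℂ) : Prop :=
  Submodule.span ℝ (commutatorExpressions (Complex.I • H₀) (Complex.I • H₁) ∪
    {Complex.I • H₁}) = L.toSubmodule

/-- `U` solves the Schrödinger equation `i U'(t) = (H₀ + f(t) H₁) U(t)`, `U(0) = 1` on `[0, T]`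
in the Carathéodory sense, i.e. it is continuous and satisfies the integral equation
(entrywise). -/
def IsPropagator {N : ℕ} (H₀ H₁ : Matrix (Fin N) (Fin N) ℂ) (f : ℝ → ℝ) (T : ℝ)
    (U : ℝ → Matrix (Fin N) (Fin N) ℂ) : Prop :=
  ContinuousOn U (Set.Icc 0 T) ∧
  ∀ t ∈ Set.Icc 0 T, ∀ j k : Fin N,
    U t j k = (1 : Matrix (Fin N) (Fin N) ℂ) j k +
      ∫ s in (0 : ℝ)..t, (-Complex.I) * (((H₀ + (f s : ℂ) • H₁) * U s) j k)

/-- Some real control `f ∈ L²(0, T)` takes the system `H₀ + f(t) H₁` from the identity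
to `g` in time exactly `T`, where `T > 0`. -/
def Reaches {N : ℕ} (H₀ H₁ : Matrix (Fin N) (Fin N) ℂ) (T : ℝ)
    (g : Matrix (Fin N) (Fin N) ℂ) : Prop :=
  0 < T ∧ ∃ f : ℝ → ℝ, MemLp f 2 (volume.restrict (Set.Ioo 0 T)) ∧
    ∃ U : ℝ → Matrix (Fin N) (Fin N) ℂ, IsPropagator H₀ H₁ f T U ∧ U T = g

end

/-! Piecewise constant controls suffice. Among them choose one whose endpoint has maximal rank as a
function of the durations. A further piece then adds no new direction, so the velocity space,
translated to the identity, contains a subspace that holds both generators and is stable under their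
adjoint actions (`IsMaximalWord.exists_submodule`). By the rank condition it contains `L`, so the
endpoint map covers all directions tangent to `G`.

To stay in the flat matrix algebra, a transversal `κ` supplies the directions normal to `G`. The map
`(s, p, y) ↦ (s, κ y * φ (s, p))`, with `p` the durations, is then a submersion and covers a product
neighborhood `V × W` (`exists_word_nhds_covered`). For targets in `G` the factor `κ y` is forced to
be `1`, so every system in `V` reaches all of `W ∩ G` in bounded time. Keeping `s` as a variable is
what gives robustness. Compactness yields `G ⊆ (W ∩ G) ^ k` with `k` independent of `s`
(`exists_subset_pow_of_nhds`), hence a common time bound.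

For exact time, the same argument runs in `𝔸 × ℝ`, whose second coordinate records `exp` of the
elapsed time. All of `G` is then reached at one common time, and a preliminary drift of any positive
length gives every later time. -/

/-! ### Piecewise constant controls, words of maximal rank, local covering -/

section Words

open NormedSpace Filter

variable {𝔸 : Type*} [NormedRing 𝔸] [NormedAlgebra ℝ 𝔸]

/-- The total duration of a word of pairs (duration, control value). -/
noncomputable def duration (w : List (ℝ × ℝ)) : ℝ := (w.map Prod.fst).sum

/-- All durations in the word are positive. -/
def IsPositiveWord (w : List (ℝ × ℝ)) : Prop := ∀ l ∈ w, 0 < l.1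

/-- The endpoint of `X' = (s.1 + u s.2) X`, `X 0 = 1` for the piecewise constant control `u`
encoded by a word, the head of the list being the last piece. -/
noncomputable def endpoint (s : 𝔸 × 𝔸) : List (ℝ × ℝ) → 𝔸
  | [] => 1
  | l :: w => exp (l.1 • (s.1 + l.2 • s.2)) * endpoint s w

/-- The span of the partial derivatives of the endpoint with respect to the durations. -/
noncomputable def velocities (s : 𝔸 × 𝔸) : List (ℝ × ℝ) → Submodule ℝ 𝔸
  | [] => ⊥
  | l :: w => (velocities s w ⊔ Submodule.span ℝ {(s.1 + l.2 • s.2) * endpoint s w}).map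
      (LinearMap.mulLeft ℝ (exp (l.1 • (s.1 + l.2 • s.2))))

lemma duration_nil : duration [] = 0 := rfl

lemma duration_cons (l : ℝ × ℝ) (w : List (ℝ × ℝ)) : duration (l :: w) = l.1 + duration w := by
  simp [duration]

lemma duration_append (w w' : List (ℝ × ℝ)) :
    duration (w ++ w') = duration w + duration w' := by
  simp [duration]

lemma isPositiveWord_nil : IsPositiveWord [] := by simp [IsPositiveWord]

lemma isPositiveWord_cons {l : ℝ × ℝ} {w : List (ℝ × ℝ)} :
    IsPositiveWord (l :: w) ↔ 0 < l.1 ∧ IsPositiveWord w := by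
  simp [IsPositiveWord]

lemma IsPositiveWord.append {w w' : List (ℝ × ℝ)} (h : IsPositiveWord w)
    (h' : IsPositiveWord w') : IsPositiveWord (w ++ w') := by
  intro l hl
  rcases List.mem_append.1 hl with hl | hl
  exacts [h l hl, h' l hl]

lemma IsPositiveWord.duration_nonneg {w : List (ℝ × ℝ)} (h : IsPositiveWord w) :
    0 ≤ duration w := by
  refine List.sum_nonneg fun x hx => ?_
  obtain ⟨l, hl, rfl⟩ := List.mem_map.1 hx
  exact (h l hl).le

lemma endpoint_append (s : 𝔸 × 𝔸) (w w' : List (ℝ × ℝ)) :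
    endpoint s (w ++ w') = endpoint s w * endpoint s w' := by
  induction w with
  | nil => simp [endpoint]
  | cons l w ih => simp [endpoint, ih, mul_assoc]

lemma injective_mulLeft_of_isUnit {x : 𝔸} (hx : IsUnit x) :
    Function.Injective (LinearMap.mulLeft ℝ x) := fun _ _ h => hx.mul_left_cancel h

lemma finrank_map_mulLeft {x : 𝔸} (hx : IsUnit x) (p : Submodule ℝ 𝔸) :
    Module.finrank ℝ (p.map (LinearMap.mulLeft ℝ x)) = Module.finrank ℝ p :=
  (Submodule.equivMapOfInjective _ (injective_mulLeft_of_isUnit hx) p).finrank_eq.symm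

/-- The word `w` has a velocity space of maximal dimension. -/
def IsMaximalWord (s : 𝔸 × 𝔸) (w : List (ℝ × ℝ)) : Prop :=
  IsPositiveWord w ∧ ∀ w', IsPositiveWord w' →
    Module.finrank ℝ (velocities s w') ≤ Module.finrank ℝ (velocities s w)

lemma exists_isMaximalWord [FiniteDimensional ℝ 𝔸] (s : 𝔸 × 𝔸) : ∃ w, IsMaximalWord s w := by
  let S : Set ℕ := {d | ∃ w, IsPositiveWord w ∧ Module.finrank ℝ (velocities s w) = d}
  have hS : S.Finite := (Set.finite_Iic (Module.finrank ℝ 𝔸)).subset (by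
    rintro _ ⟨w, -, rfl⟩
    exact Submodule.finrank_le _)
  obtain ⟨d, ⟨w, hw, rfl⟩, hd⟩ := hS.exists_maximal ⟨_, [], isPositiveWord_nil, rfl⟩
  exact ⟨w, hw, fun w' hw' => (le_total _ _).elim id fun h => hd ⟨w', hw', rfl⟩ h⟩

variable [CompleteSpace 𝔸]

lemma exp_mul_exp_neg_real (x : 𝔸) : exp x * exp (-x) = 1 := by
  let +nondep : NormedAlgebra ℚ 𝔸 := .restrictScalars ℚ ℝ 𝔸
  rw [← NormedSpace.exp_add_of_commute (Commute.neg_right rfl)]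
  simp

lemma exp_neg_mul_exp_real (x : 𝔸) : exp (-x) * exp x = 1 := by
  simpa using exp_mul_exp_neg_real (-x)

lemma isUnit_exp_real (x : 𝔸) : IsUnit (exp x) :=
  ⟨⟨exp x, exp (-x), exp_mul_exp_neg_real x, exp_neg_mul_exp_real x⟩, rfl⟩

lemma isUnit_endpoint (s : 𝔸 × 𝔸) (w : List (ℝ × ℝ)) : IsUnit (endpoint s w) := by
  induction w with
  | nil => exact isUnit_one
  | cons l w ih => exact (isUnit_exp_real _).mul ih

lemma contDiff_exp_real {n : WithTop ℕ∞} : ContDiff ℝ n (exp : 𝔸 → 𝔸) :=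
  contDiff_iff_contDiffAt.2 fun x => (exp_analytic (𝕂 := ℝ) x).contDiffAt

/-- The derivative at `0` of the adjoint action along a one-parameter subgroup. -/
lemma hasDerivAt_exp_neg_mul_mul_exp (x y : 𝔸) :
    HasDerivAt (fun t : ℝ => exp (-(t • x)) * y * exp (t • x)) (y * x - x * y) 0 := by
  have h₁ := hasDerivAt_exp_smul_const (𝕂 := ℝ) (-x) 0
  have h₂ := hasDerivAt_exp_smul_const (𝕂 := ℝ) x 0
  have := (h₁.mul_const y).mul h₂
  simp only [zero_smul, exp_zero, one_mul, mul_one, smul_neg, neg_zero] at this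
  refine this.congr_deriv ?_
  noncomm_ring

/-- A closed subspace which is invariant under `Ad (exp (-t x))` for `t > 0`
is invariant under `ad x`. -/
lemma lie_mem_of_forall_exp_conj_mem [FiniteDimensional ℝ 𝔸] (U : Submodule ℝ 𝔸) {x y : 𝔸}
    (hy : y ∈ U) (h : ∀ t : ℝ, 0 < t → exp (-(t • x)) * y * exp (t • x) ∈ U) :
    ⁅x, y⁆ ∈ U := by
  -- The slope is taken from the right, since only positive times are available.
  have hd := (hasDerivAt_exp_neg_mul_mul_exp x y).tendsto_slope_zero_right
  have hcl : IsClosed (U : Set 𝔸) := U.closed_of_finiteDimensional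
  have hmem : y * x - x * y ∈ (U : Set 𝔸) := by
    refine hcl.mem_of_tendsto hd ?_
    filter_upwards [self_mem_nhdsWithin] with t ht
    simp only [zero_add, zero_smul, neg_zero, exp_zero, one_mul, mul_one]
    exact U.smul_mem _ (U.sub_mem (h t ht) hy)
  rw [Ring.lie_def, ← neg_sub]
  exact U.neg_mem hmem

/-- Prolonging the word by one piece multiplies by a unit, which preserves dimension; by maximality
the direction adjoined beforehand was already present. The duration `1` is arbitrary. -/
lemma IsMaximalWord.mul_mem [FiniteDimensional ℝ 𝔸] {s : 𝔸 × 𝔸} {w : List (ℝ × ℝ)}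
    (hw : IsMaximalWord s w) (u : ℝ) : (s.1 + u • s.2) * endpoint s w ∈ velocities s w := by
  have h := hw.2 ((1, u) :: w) (isPositiveWord_cons.2 ⟨one_pos, hw.1⟩)
  rw [velocities, finrank_map_mulLeft (isUnit_exp_real _)] at h
  have := Submodule.eq_of_le_of_finrank_le le_sup_left h
  rw [this]
  exact Submodule.mem_sup_right (Submodule.mem_span_singleton_self _)

lemma IsMaximalWord.cons [FiniteDimensional ℝ 𝔸] {s : 𝔸 × 𝔸} {w : List (ℝ × ℝ)}
    (hw : IsMaximalWord s w) {l : ℝ × ℝ} (hl : 0 < l.1) :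
    IsMaximalWord s (l :: w) ∧ velocities s (l :: w) =
      (velocities s w).map (LinearMap.mulLeft ℝ (exp (l.1 • (s.1 + l.2 • s.2)))) := by
  have h : velocities s (l :: w) =
      (velocities s w).map (LinearMap.mulLeft ℝ (exp (l.1 • (s.1 + l.2 • s.2)))) := by
    rw [velocities, sup_eq_left.2]
    rw [Submodule.span_singleton_le_iff_mem]
    exact hw.mul_mem l.2
  refine ⟨⟨isPositiveWord_cons.2 ⟨hl, hw.1⟩, fun w' hw' => (hw.2 w' hw').trans ?_⟩, h⟩
  rw [h, finrank_map_mulLeft (isUnit_exp_real _)]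

lemma IsMaximalWord.append [FiniteDimensional ℝ 𝔸] {s : 𝔸 × 𝔸} {w : List (ℝ × ℝ)}
    (hw : IsMaximalWord s w) {w' : List (ℝ × ℝ)} (hw' : IsPositiveWord w') :
    IsMaximalWord s (w' ++ w) ∧ velocities s (w' ++ w) =
      (velocities s w).map (LinearMap.mulLeft ℝ (endpoint s w')) := by
  induction w' with
  | nil => simpa [endpoint] using! hw
  | cons l w' ih =>
    obtain ⟨hl, hw'⟩ := isPositiveWord_cons.1 hw'
    obtain ⟨h₁, h₂⟩ := ih hw'
    obtain ⟨h₃, h₄⟩ := h₁.cons hl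
    refine ⟨h₃, ?_⟩
    rw [List.cons_append, h₄, h₂, ← Submodule.map_comp, endpoint, LinearMap.mulLeft_mul]

/-- For a word with velocity space of maximal dimension, the velocity space contains the right
translate of a subspace which contains the generators and is invariant under their adjoint
actions. -/
lemma IsMaximalWord.exists_submodule [FiniteDimensional ℝ 𝔸] {s : 𝔸 × 𝔸} {w : List (ℝ × ℝ)}
    (hw : IsMaximalWord s w) :
    ∃ U : Submodule ℝ 𝔸, s.1 ∈ U ∧ s.2 ∈ U ∧ (∀ y ∈ U, ⁅s.1, y⁆ ∈ U ∧ ⁅s.2, y⁆ ∈ U) ∧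
      ∀ y ∈ U, y * endpoint s w ∈ velocities s w := by
  -- The intersection, over all prolongations `w'`, of the velocity spaces translated to the
  -- identity. Quantifying over all `w'` is what makes it stable under conjugation: a conjugation by
  -- `exp (-(t • x))` is absorbed by the prolongation `(t, u) :: w'`.
  let U : Submodule ℝ 𝔸 :=
    { carrier := {y | ∀ w', IsPositiveWord w' → y * (endpoint s w' * endpoint s w) ∈
        (velocities s w).map (LinearMap.mulLeft ℝ (endpoint s w'))}
      add_mem' := fun {y z} hy hz w' hw' => by
        rw [add_mul]; exact add_mem (hy w' hw') (hz w' hw')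
      zero_mem' := fun w' _ => by rw [zero_mul]; exact zero_mem _
      smul_mem' := fun c y hy w' hw' => by
        rw [smul_mul_assoc]; exact Submodule.smul_mem _ c (hy w' hw') }
  have hgen : ∀ u : ℝ, s.1 + u • s.2 ∈ U := fun u w' hw' => by
    obtain ⟨h₁, h₂⟩ := hw.append hw'
    have := h₁.mul_mem u
    rwa [h₂, endpoint_append] at this
  have hlie : ∀ u : ℝ, ∀ y ∈ U, ⁅s.1 + u • s.2, y⁆ ∈ U := fun u y hy => by
    refine lie_mem_of_forall_exp_conj_mem U hy fun t ht w' hw' => ?_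
    obtain ⟨v, hv, hvy⟩ := hy ((t, u) :: w') (isPositiveWord_cons.2 ⟨ht, hw'⟩)
    refine ⟨v, hv, ?_⟩
    simp only [endpoint, LinearMap.mulLeft_apply] at hvy ⊢
    have := congrArg (exp (-(t • (s.1 + u • s.2))) * ·) hvy
    simp only [← mul_assoc, exp_neg_mul_exp_real, one_mul] at this
    rw [this]
    simp only [mul_assoc]
  have h1 : s.1 ∈ U := by simpa using hgen 0
  have hs2 : s.2 = (s.1 + (1 : ℝ) • s.2) - (s.1 + (0 : ℝ) • s.2) := by simp
  refine ⟨U, h1, ?_, fun y hy => ⟨by simpa using hlie 0 y hy, ?_⟩, fun y hy => ?_⟩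
  · rw [hs2]; exact sub_mem (hgen 1) (hgen 0)
  · rw [hs2, sub_lie]; exact sub_mem (hlie 1 y hy) (hlie 0 y hy)
  · simpa [endpoint] using hy [] isPositiveWord_nil

/-- Varying the durations in a positive word parametrizes endpoints of positive words, with
partial derivatives spanning the velocity space. -/
lemma exists_parametrization (s₀ : 𝔸 × 𝔸) {w : List (ℝ × ℝ)} (hw : IsPositiveWord w) :
    ∃ (E : Type) (_ : NormedAddCommGroup E) (_ : NormedSpace ℝ E) (_ : CompleteSpace E)
      (φ : (𝔸 × 𝔸) × E → 𝔸) (p₀ : E) (D : ℝ), ContDiff ℝ 1 φ ∧ φ (s₀, p₀) = endpoint s₀ w ∧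
      (∀ᶠ p in 𝓝 p₀, ∀ s, ∃ w', IsPositiveWord w' ∧ duration w' ≤ D ∧ endpoint s w' = φ (s, p)) ∧
      ∀ v ∈ velocities s₀ w, ∃ e : E, HasDerivAt (fun r : ℝ => φ (s₀, p₀ + r • e)) v 0 := by
  induction w with
  | nil =>
    refine ⟨Fin 0 → ℝ, inferInstance, inferInstance, inferInstance, fun _ => 1, 0, 0,
      contDiff_const, rfl, .of_forall fun p s => ⟨[], isPositiveWord_nil, le_rfl, rfl⟩,
      fun v hv => ⟨0, ?_⟩⟩
    rw [velocities, Submodule.mem_bot] at hv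
    subst hv
    exact hasDerivAt_const _ _
  | cons l w ih =>
    obtain ⟨hl, hw⟩ := isPositiveWord_cons.1 hw
    obtain ⟨E, _, _, _, φ, p₀, D, hφ, hp₀, hev, hder⟩ := ih hw
    refine ⟨E × ℝ, inferInstance, inferInstance, inferInstance,
      fun q => exp (q.2.2 • (q.1.1 + l.2 • q.1.2)) * φ (q.1, q.2.1), (p₀, l.1), l.1 + 1 + D,
      ?_, ?_, ?_, ?_⟩
    · refine (contDiff_exp_real.comp ?_).mul (hφ.comp ?_) <;> fun_prop
    · simp only [endpoint, hp₀]
    · rw [nhds_prod_eq]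
      -- The perturbed duration must stay positive, and below a bound that does not depend on the
      -- system.
      have h2 : ∀ᶠ t in 𝓝 l.1, 0 < t ∧ t < l.1 + 1 :=
        Ioo_mem_nhds hl (lt_add_one _)
      filter_upwards [hev.prod_mk h2] with q hq s
      obtain ⟨w', hw', hD, hs⟩ := hq.1 s
      refine ⟨(q.2, l.2) :: w', isPositiveWord_cons.2 ⟨hq.2.1, hw'⟩, ?_, ?_⟩
      · rw [duration_cons]
        exact add_le_add hq.2.2.le hD
      · simp only [endpoint, hs]
    · rintro _ ⟨x, hx, rfl⟩
      obtain ⟨v, hv, z, hz, rfl⟩ := Submodule.mem_sup.1 hx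
      obtain ⟨r, rfl⟩ := Submodule.mem_span_singleton.1 hz
      obtain ⟨e, he⟩ := hder v hv
      refine ⟨(e, r), ?_⟩
      have h₁ : HasDerivAt (fun t : ℝ => l.1 + t * r) r 0 := by
        simpa using ((hasDerivAt_id (0 : ℝ)).mul_const r).const_add l.1
      have h₂ := hasDerivAt_exp_smul_const (𝕂 := ℝ) (s₀.1 + l.2 • s₀.2) (l.1 + 0 * r)
      have h₃ := (h₂.scomp (0 : ℝ) h₁).mul he
      convert! h₃ using 1
      simp only [Function.comp_apply, zero_smul, add_zero, zero_mul, hp₀]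
      rw [LinearMap.mulLeft_apply]
      rw [mul_add, smul_mul_assoc, mul_smul_comm, mul_assoc, add_comm]

/-- Local controllability around the endpoint of a suitable word, uniformly in the system and
modulo a transversal `κ`. -/
theorem exists_word_nhds_covered [FiniteDimensional ℝ 𝔸] {K : Type*} [NormedAddCommGroup K]
    [NormedSpace ℝ K] [CompleteSpace K] {κ : K → 𝔸} {κ' : K →L[ℝ] 𝔸}
    (hκ : HasStrictFDerivAt κ κ' 0) (hκ1 : κ 0 = 1) (s₀ : 𝔸 × 𝔸)
    (hU : ∀ U : Submodule ℝ 𝔸, s₀.1 ∈ U → s₀.2 ∈ U →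
      (∀ y ∈ U, ⁅s₀.1, y⁆ ∈ U ∧ ⁅s₀.2, y⁆ ∈ U) → U ⊔ LinearMap.range κ'.toLinearMap = ⊤) :
    ∃ w D, IsPositiveWord w ∧ ∀ Y ∈ 𝓝 (0 : K), ∃ V ∈ 𝓝 s₀, ∃ W ∈ 𝓝 (endpoint s₀ w),
      ∀ s ∈ V, ∀ g ∈ W, ∃ w', IsPositiveWord w' ∧ duration w' ≤ D ∧
        ∃ y ∈ Y, κ y * endpoint s w' = g := by
  obtain ⟨w, hw⟩ := exists_isMaximalWord s₀
  obtain ⟨U, h1, h2, h3, h4⟩ := hw.exists_submodule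
  have htop := hU U h1 h2 h3
  obtain ⟨E, _, _, _, φ, p₀, D, hφ, hp₀, hev, hder⟩ := exists_parametrization s₀ hw.1
  refine ⟨w, D, hw.1, fun Y hY => ?_⟩
  -- Carrying `s` along unchanged turns openness of one map into a covering that is uniform in the
  -- system.
  let F : (𝔸 × 𝔸) × (E × K) → (𝔸 × 𝔸) × 𝔸 := fun q => (q.1, κ q.2.2 * φ (q.1, q.2.1))
  have hφ' : HasStrictFDerivAt φ (fderiv ℝ φ (s₀, p₀)) (s₀, p₀) :=
    hφ.contDiffAt.hasStrictFDerivAt one_ne_zero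
  set φ' := fderiv ℝ φ (s₀, p₀)
  let ι : (𝔸 × 𝔸) × (E × K) →L[ℝ] (𝔸 × 𝔸) × E :=
    (ContinuousLinearMap.fst ℝ _ _).prod
      ((ContinuousLinearMap.fst ℝ _ _).comp (ContinuousLinearMap.snd ℝ _ _))
  let π : (𝔸 × 𝔸) × (E × K) →L[ℝ] K :=
    (ContinuousLinearMap.snd ℝ _ _).comp (ContinuousLinearMap.snd ℝ _ _)
  have hF1 : HasStrictFDerivAt (fun q : (𝔸 × 𝔸) × (E × K) => φ (q.1, q.2.1)) (φ'.comp ι)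
      (s₀, (p₀, 0)) :=
    HasStrictFDerivAt.comp (f := ι) (s₀, (p₀, (0 : K))) hφ' ι.hasStrictFDerivAt
  have hF2 : HasStrictFDerivAt (fun q : (𝔸 × 𝔸) × (E × K) => κ q.2.2) (κ'.comp π)
      (s₀, (p₀, 0)) :=
    HasStrictFDerivAt.comp (f := π) (s₀, (p₀, (0 : K))) hκ π.hasStrictFDerivAt
  have hF := hasStrictFDerivAt_fst.prodMk (hF2.mul' hF1)
  have hsurj := hF.map_nhds_eq_of_surj (f := F) (by
    rw [LinearMap.range_eq_top]
    rintro ⟨σ, m⟩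
    obtain ⟨P, hP⟩ := isUnit_endpoint s₀ w
    -- The contribution of the system variation `σ` is subtracted and the rest is translated to the
    -- identity, where it splits into a reachable and a transversal part.
    obtain ⟨y, hy, _, ⟨k, rfl⟩, hk⟩ := Submodule.mem_sup.1
      (htop ▸ Submodule.mem_top : (m - φ' (σ, 0)) * (↑P⁻¹ : 𝔸) ∈ _)
    obtain ⟨e, he⟩ := hder _ (h4 y hy)
    have he' : φ' (0, e) = y * endpoint s₀ w := by
      refine HasDerivAt.unique ?_ he
      have hl : HasDerivAt (fun r : ℝ => ((s₀, p₀ + r • e) : (𝔸 × 𝔸) × E)) (0, e) 0 := by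
        have := ((hasDerivAt_id (0 : ℝ)).smul_const e).const_add p₀
        simp only [one_smul] at this
        exact (hasDerivAt_const _ _).prodMk this
      refine HasFDerivAt.comp_hasDerivAt (0 : ℝ) (l := φ) ?_ hl
      simpa using hφ'.hasFDerivAt
    refine ⟨(σ, (e, k)), ?_⟩
    have hsplit : φ' (σ, e) = φ' (σ, 0) + φ' (0, e) := by
      rw [← map_add]; simp
    have hm : m = φ' (σ, 0) + (y + κ' k) * endpoint s₀ w := by
      have := congrArg (· * (P : 𝔸)) hk
      simp only [mul_assoc, Units.inv_mul, mul_one] at this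
      rw [← hP]
      simp only [ContinuousLinearMap.coe_coe] at this
      rw [this]; abel
    simp [ι, π, hκ1, hp₀, hsplit, he', hm, add_mul, add_assoc])
  have hset : {q : (𝔸 × 𝔸) × (E × K) | (∀ s, ∃ w', IsPositiveWord w' ∧ duration w' ≤ D ∧
      endpoint s w' = φ (s, q.2.1)) ∧ q.2.2 ∈ Y} ∈ 𝓝 (s₀, (p₀, (0 : K))) := by
    rw [nhds_prod_eq (X := 𝔸 × 𝔸), nhds_prod_eq (X := E)]
    exact (hev.prod_mk hY).prod_inr _
  have himg := hsurj ▸ image_mem_map hset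
  have hFp : F (s₀, (p₀, 0)) = (s₀, endpoint s₀ w) := by simp [F, hκ1, hp₀]
  rw [hFp] at himg
  obtain ⟨V, hV, W, hW, hVW⟩ := mem_nhds_prod_iff.1 himg
  refine ⟨V, hV, W, hW, fun s hs g hg => ?_⟩
  obtain ⟨q, ⟨hq, hqY⟩, hqF⟩ := hVW (Set.mk_mem_prod hs hg)
  obtain ⟨w', hw', hD, hP⟩ := hq q.1
  simp only [F, Prod.mk.injEq] at hqF
  exact ⟨w', hw', hD, q.2.2, hqY, by rw [← hqF.2, ← hqF.1, hP]⟩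

end Words

/-! ### Trajectories of piecewise constant controls as Carathéodory solutions -/

section Trajectories

open NormedSpace

/-- The piecewise constant control encoded by a word. -/
noncomputable def controlOf : List (ℝ × ℝ) → ℝ → ℝ
  | [], _ => 0
  | l :: w, t => if t ≤ duration w then controlOf w t else l.2

lemma measurable_control (w : List (ℝ × ℝ)) : Measurable (controlOf w) := by
  induction w with
  | nil => exact measurable_const
  | cons l w ih => exact Measurable.ite measurableSet_Iic ih measurable_const

lemma exists_abs_control_le (w : List (ℝ × ℝ)) : ∃ C, ∀ t, |controlOf w t| ≤ C := by
  induction w with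
  | nil => exact ⟨0, fun t => by simp [controlOf]⟩
  | cons l w ih =>
    obtain ⟨C, hC⟩ := ih
    refine ⟨max C |l.2|, fun t => ?_⟩
    simp only [controlOf]
    split_ifs
    exacts [le_max_of_le_left (hC t), le_max_right _ _]

lemma memLp_control (w : List (ℝ × ℝ)) (p : ENNReal) (μ : Measure ℝ) [IsFiniteMeasure μ] :
    MemLp (controlOf w) p μ := by
  obtain ⟨C, hC⟩ := exists_abs_control_le w
  exact MemLp.of_bound (measurable_control w).aestronglyMeasurable C (.of_forall hC)

lemma intervalIntegrable_control (w : List (ℝ × ℝ)) (x y : ℝ) :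
    IntervalIntegrable (controlOf w) volume x y := by
  rw [intervalIntegrable_iff]
  have : IsFiniteMeasure (volume.restrict (Set.uIoc x y)) := ⟨by simp [Set.uIoc]⟩
  exact memLp_one_iff_integrable.1 (memLp_control w 1 _)

variable {𝔸 : Type*} [NormedRing 𝔸] [NormedAlgebra ℝ 𝔸]

/-- The solution of `X' = (s.1 + u s.2) X`, `X 0 = 1` for the control `u` encoded by a word. -/
noncomputable def trajectory (s : 𝔸 × 𝔸) : List (ℝ × ℝ) → ℝ → 𝔸
  | [], _ => 1
  | l :: w, t => if t ≤ duration w then trajectory s w t else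
      exp ((t - duration w) • (s.1 + l.2 • s.2)) * endpoint s w

lemma trajectory_duration (s : 𝔸 × 𝔸) {w : List (ℝ × ℝ)} (hw : IsPositiveWord w) :
    trajectory s w (duration w) = endpoint s w := by
  cases w with
  | nil => rfl
  | cons l w =>
    have := (isPositiveWord_cons.1 hw).1
    rw [trajectory, if_neg (by rw [duration_cons]; linarith), duration_cons, endpoint]
    simp

variable [CompleteSpace 𝔸]

lemma continuous_trajectory (s : 𝔸 × 𝔸) {w : List (ℝ × ℝ)} (hw : IsPositiveWord w) :
    Continuous (trajectory s w) := by
  induction w with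
  | nil => exact continuous_const
  | cons l w ih =>
    have hw' := (isPositiveWord_cons.1 hw).2
    refine Continuous.if_le (ih hw') ?_ continuous_id continuous_const ?_
    · exact ((contDiff_exp_real (n := 0)).continuous.comp (by fun_prop)).mul continuous_const
    · rintro x rfl
      simp [trajectory_duration s hw']

lemma intervalIntegrable_control_mul_trajectory (s : 𝔸 × 𝔸) {w : List (ℝ × ℝ)}
    (hw : IsPositiveWord w) (x y : ℝ) :
    IntervalIntegrable (fun t => (s.1 + controlOf w t • s.2) * trajectory s w t) volume x y := by
  have hc := continuous_trajectory s hw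
  have h₁ := (continuous_const.mul hc : Continuous fun t => s.1 * trajectory s w t)
  have h₂ := (continuous_const.mul hc : Continuous fun t => s.2 * trajectory s w t)
  refine ((h₁.intervalIntegrable x y).add
    ((intervalIntegrable_control w x y).smul_continuousOn h₂.continuousOn)).congr ?_
  intro t _
  simp only [add_mul, smul_mul_assoc, Pi.mul_apply]

lemma trajectory_eq_integral (s : 𝔸 × 𝔸) {w : List (ℝ × ℝ)} (hw : IsPositiveWord w) {t : ℝ}
    (ht : t ∈ Set.Icc 0 (duration w)) :
    trajectory s w t = 1 + ∫ x in (0 : ℝ)..t, (s.1 + controlOf w x • s.2) * trajectory s w x := by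
  induction w generalizing t with
  | nil =>
    have : t = 0 := le_antisymm ht.2 ht.1
    simp [this, trajectory]
  | cons l w ih =>
    have hw' := (isPositiveWord_cons.1 hw).2
    have h0 := hw'.duration_nonneg
    -- Up to the last switching time, the control and trajectory agree with those of the shorter
    -- word.
    have hold : ∀ y, 0 ≤ y → y ≤ duration w →
        trajectory s w y = 1 + ∫ x in (0 : ℝ)..y,
          (s.1 + controlOf (l :: w) x • s.2) * trajectory s (l :: w) x := fun y hy hyw => by
      rw [ih hw' ⟨hy, hyw⟩]
      congr 1
      refine intervalIntegral.integral_congr fun x hx => ?_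
      rw [Set.uIcc_of_le hy] at hx
      simp only [controlOf, trajectory, if_pos (hx.2.trans hyw)]
    rcases le_or_gt t (duration w) with h | h
    · rw [← hold t ht.1 h, trajectory, if_pos h]
    · have hint := intervalIntegrable_control_mul_trajectory s hw
      rw [← intervalIntegral.integral_add_adjacent_intervals (hint 0 (duration w)) (hint _ t),
        ← add_assoc, ← hold _ h0 le_rfl, trajectory_duration s hw', trajectory, if_neg h.not_ge]
      have hcongr : ∫ x in (duration w)..t, (s.1 + controlOf (l :: w) x • s.2) *
          trajectory s (l :: w) x = ∫ x in (duration w)..t, (s.1 + l.2 • s.2) *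
            exp ((x - duration w) • (s.1 + l.2 • s.2)) * endpoint s w := by
        refine intervalIntegral.integral_congr_ae (.of_forall fun x hx => ?_)
        rw [Set.uIoc_of_le h.le] at hx
        simp only [controlOf, trajectory, if_neg hx.1.not_ge, mul_assoc]
      have hderiv : ∀ x, HasDerivAt
          (fun x => exp ((x - duration w) • (s.1 + l.2 • s.2)) * endpoint s w)
          ((s.1 + l.2 • s.2) * exp ((x - duration w) • (s.1 + l.2 • s.2)) * endpoint s w) x :=
        fun x => ((hasDerivAt_exp_smul_const' (𝕂 := ℝ) (s.1 + l.2 • s.2)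
          (x - duration w)).comp_sub_const x (duration w)).mul_const _
      rw [hcongr, intervalIntegral.integral_eq_sub_of_hasDerivAt (fun x _ => hderiv x)]
      · simp
      · refine Continuous.intervalIntegrable ?_ _ _
        have : Continuous fun x : ℝ => exp ((x - duration w) • (s.1 + l.2 • s.2)) :=
          (contDiff_exp_real (n := 0)).continuous.comp (by fun_prop)
        fun_prop

end Trajectories

/-! ### Words as admissible controls of the Schrödinger equation -/

section Propagators

open scoped Matrix.Norms.Operator

variable {N : ℕ}

/-- The coefficients of the matrix differential equation `U' = (s.1 + f s.2) U` of a pair of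
Hamiltonians. -/
def generators (H₀ H₁ : Matrix (Fin N) (Fin N) ℂ) :
    Matrix (Fin N) (Fin N) ℂ × Matrix (Fin N) (Fin N) ℂ :=
  (-(Complex.I • H₀), -(Complex.I • H₁))

theorem reaches_endpoint (H₀ H₁ : Matrix (Fin N) (Fin N) ℂ) {w : List (ℝ × ℝ)}
    (hw : IsPositiveWord w) (h0 : 0 < duration w) :
    Reaches H₀ H₁ (duration w) (endpoint (generators H₀ H₁) w) := by
  refine ⟨h0, controlOf w, memLp_control w 2 _, trajectory (generators H₀ H₁) w,
    ⟨(continuous_trajectory _ hw).continuousOn, fun t ht j k => ?_⟩, trajectory_duration _ hw⟩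
  let entry : Matrix (Fin N) (Fin N) ℂ →L[ℝ] ℂ :=
    (Matrix.entryLinearMap ℝ ℂ j k).toContinuousLinearMap
  have h := congrArg entry (trajectory_eq_integral (generators H₀ H₁) hw ht)
  have hI := entry.intervalIntegral_comp_comm
    (intervalIntegrable_control_mul_trajectory (generators H₀ H₁) hw 0 t)
  refine (h.trans ((map_add entry _ _).trans (congrArg _ hI.symm))).trans (congrArg _
    (intervalIntegral.integral_congr fun x _ => ?_))
  have : (generators H₀ H₁).1 + controlOf w x • (generators H₀ H₁).2 =
      (-Complex.I) • (H₀ + (controlOf w x : ℂ) • H₁) := by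
    ext i j
    simp [generators]
    ring
  simp only [this, smul_mul_assoc]
  rfl

end Propagators

/-! ### Exponentials in the unitary and special unitary groups -/

section UnitaryExponential

open NormedSpace

variable {N : ℕ}

lemma mem_uLie {A : Matrix (Fin N) (Fin N) ℂ} : A ∈ uLie N ↔ Aᴴ = -A := Iff.rfl

lemma I_smul_mem_uLie {A : Matrix (Fin N) (Fin N) ℂ} (hA : A.IsHermitian) :
    Complex.I • A ∈ uLie N := by
  rw [mem_uLie, conjTranspose_smul, hA.eq]
  simp

lemma isHermitian_neg_I_smul {A : Matrix (Fin N) (Fin N) ℂ} (hA : A ∈ uLie N) :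
    ((-Complex.I) • A).IsHermitian := by
  rw [IsHermitian, conjTranspose_smul, mem_uLie.1 hA]
  simp

/-- The spectrum is finite, so some `e^{iφ}` avoids it; rotation by `π - φ` moves this gap to `-1`.
The rotated unitary then has a principal logarithm. -/
lemma exists_smul_neg_one_notMem_spectrum (g : Matrix (Fin N) (Fin N) ℂ) :
    ∃ θ : ℝ, (-1 : ℂ) ∉ spectrum ℂ (Complex.exp (θ * Complex.I) • g) := by
  obtain ⟨φ, hφ, hφg⟩ := (Set.Ioc_infinite (show -Real.pi < Real.pi by
    linarith [Real.pi_pos])).exists_notMem_finite ((Matrix.finite_spectrum g).image Complex.arg)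
  have hz : Complex.exp (φ * Complex.I) ∉ spectrum ℂ g := fun h =>
    hφg ⟨_, h, by
      rw [Complex.arg_exp_mul_I, toIocMod_eq_self, show -Real.pi + 2 * Real.pi = Real.pi by ring]
      exact hφ⟩
  refine ⟨Real.pi - φ, ?_⟩
  rw [spectrum.notMem_iff] at hz ⊢
  have h1 : (-1 : ℂ) = Complex.exp (((Real.pi - φ : ℝ) : ℂ) * Complex.I) *
      Complex.exp (φ * Complex.I) := by
    rw [← Complex.exp_add, ← add_mul]
    simp [Complex.exp_pi_mul_I]
  have h2 : algebraMap ℂ (Matrix (Fin N) (Fin N) ℂ) (-1) -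
      Complex.exp (((Real.pi - φ : ℝ) : ℂ) * Complex.I) • g =
      (Units.mk0 _ (Complex.exp_ne_zero (((Real.pi - φ : ℝ) : ℂ) * Complex.I))) •
        (algebraMap ℂ (Matrix (Fin N) (Fin N) ℂ) (Complex.exp (φ * Complex.I)) - g) := by
    rw [h1, Units.smul_mk0, smul_sub, Algebra.algebraMap_eq_smul_one, Algebra.algebraMap_eq_smul_one,
      smul_smul]
  rw [h2]
  exact hz.smul _

lemma exp_mul_I_smul_mem_unitaryGroup (θ : ℝ) {g : Matrix (Fin N) (Fin N) ℂ}
    (hg : g ∈ unitaryGroup (Fin N) ℂ) :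
    Complex.exp (θ * Complex.I) • g ∈ unitaryGroup (Fin N) ℂ := by
  rw [mem_unitaryGroup_iff] at hg ⊢
  rw [star_smul, smul_mul_smul_comm, hg, Complex.star_def, ← Complex.exp_conj, ← Complex.exp_add]
  simp

open scoped Matrix.Norms.L2Operator in
lemma exp_smul_one_add (c : ℂ) (X : Matrix (Fin N) (Fin N) ℂ) :
    exp (c • (1 : Matrix (Fin N) (Fin N) ℂ) + X) = Complex.exp c • exp X := by
  rw [Matrix.exp_add_of_commute _ _ ((Commute.one_left X).smul_left c), ← diagonal_one,
    ← diagonal_smul, Matrix.exp_diagonal, Complex.exp_eq_exp_ℂ]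
  have : exp (c • (fun _ => 1 : Fin N → ℂ)) = exp c • (fun _ => 1 : Fin N → ℂ) := by
    ext i
    rw [Pi.coe_exp]
    simp
  rw [this, diagonal_smul, diagonal_one, smul_one_mul]

open scoped Matrix.Norms.L2Operator in
/-- The exponential map of the unitary group is surjective. -/
lemma exists_exp_eq_of_mem_unitaryGroup {g : Matrix (Fin N) (Fin N) ℂ}
    (hg : g ∈ unitaryGroup (Fin N) ℂ) : ∃ X ∈ uLie N, exp X = g := by
  obtain ⟨θ, hθ⟩ := exists_smul_neg_one_notMem_spectrum g
  have hu := exp_mul_I_smul_mem_unitaryGroup θ hg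
  have h := congrArg Subtype.val (expUnitary_argSelfAdjoint (u := ⟨_, hu⟩)
    ((Unitary.norm_sub_one_lt_two_iff hu).2 hθ))
  set A := Unitary.argSelfAdjoint (⟨_, hu⟩ : unitary (Matrix (Fin N) (Fin N) ℂ))
  rw [selfAdjoint.expUnitary_coe] at h
  have hA : (A : Matrix (Fin N) (Fin N) ℂ).IsHermitian := A.2
  have h1 : (1 : Matrix (Fin N) (Fin N) ℂ).IsHermitian := isHermitian_one
  refine ⟨(-(θ * Complex.I)) • 1 + Complex.I • (A : Matrix (Fin N) (Fin N) ℂ),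
    add_mem ?_ (I_smul_mem_uLie hA), ?_⟩
  · rw [mem_uLie, conjTranspose_smul, conjTranspose_one]
    simp
  · rw [exp_smul_one_add, h, smul_smul, ← Complex.exp_add]
    simp

open scoped Matrix.Norms.L2Operator in
-- Diagonalize the Hermitian matrix `-iX` and read both sides off its eigenvalues.
lemma det_exp_of_mem_uLie {X : Matrix (Fin N) (Fin N) ℂ} (hX : X ∈ uLie N) :
    (exp X).det = Complex.exp X.trace := by
  have hA := isHermitian_neg_I_smul hX
  set A := (-Complex.I) • X with hAX
  have hXA : X = Complex.I • A := by simp [hAX, smul_smul]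
  have hs := hA.spectral_theorem
  rw [Unitary.conjStarAlgAut_apply] at hs
  let U := Unitary.toUnits hA.eigenvectorUnitary
  have hs' : X = U * diagonal (fun i => Complex.I * (hA.eigenvalues i : ℂ)) *
      ((U⁻¹ : (Matrix (Fin N) (Fin N) ℂ)ˣ) : Matrix (Fin N) (Fin N) ℂ) := by
    have : diagonal (fun i => Complex.I * (hA.eigenvalues i : ℂ)) =
        Complex.I • diagonal (RCLike.ofReal ∘ hA.eigenvalues : Fin N → ℂ) := by
      rw [← diagonal_smul]; rfl
    rw [this, Algebra.mul_smul_comm, Algebra.smul_mul_assoc, hXA]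
    exact congrArg _ hs
  have ht : X.trace = ∑ i, Complex.I * (hA.eigenvalues i : ℂ) := by
    rw [hXA, trace_smul, hA.trace_eq_sum_eigenvalues, smul_eq_mul, Finset.mul_sum]
    rfl
  rw [ht]
  conv_lhs => rw [hs', Matrix.exp_units_conj, Matrix.exp_diagonal]
  rw [det_units_conj, det_diagonal, Complex.exp_sum]
  refine Finset.prod_congr rfl fun i _ => ?_
  rw [Pi.coe_exp, Complex.exp_eq_exp_ℂ]

open scoped Matrix.Norms.L2Operator in
lemma exp_mem_unitaryGroup {X : Matrix (Fin N) (Fin N) ℂ} (hX : X ∈ uLie N) :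
    exp X ∈ unitaryGroup (Fin N) ℂ := by
  let +nondep : NormedAlgebra ℚ (Matrix (Fin N) (Fin N) ℂ) := .restrictScalars ℚ ℂ _
  exact exp_mem_unitary_of_mem_skewAdjoint hX

lemma exp_mem_specialUnitaryGroup {X : Matrix (Fin N) (Fin N) ℂ} (hX : X ∈ suLie N) :
    exp X ∈ specialUnitaryGroup (Fin N) ℂ := by
  rw [mem_specialUnitaryGroup_iff, det_exp_of_mem_uLie hX.1, hX.2, Complex.exp_zero]
  exact ⟨exp_mem_unitaryGroup hX.1, rfl⟩

/-- Each special unitary matrix is a product of two exponentials of `𝔰𝔲(N)`. -/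
lemma exists_exp_mul_exp_eq_of_mem_specialUnitaryGroup {g : Matrix (Fin N) (Fin N) ℂ}
    (hg : g ∈ specialUnitaryGroup (Fin N) ℂ) :
    ∃ X ∈ suLie N, ∃ Y ∈ suLie N, exp X * exp Y = g := by
  rcases Nat.eq_zero_or_pos N with rfl | hN
  · exact ⟨0, zero_mem _, 0, zero_mem _, Subsingleton.elim _ _⟩
  obtain ⟨hgu, hdet⟩ := mem_specialUnitaryGroup_iff.1 hg
  obtain ⟨X, hX, rfl⟩ := exists_exp_eq_of_mem_unitaryGroup hgu
  rw [det_exp_of_mem_uLie hX, Complex.exp_eq_one_iff] at hdet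
  obtain ⟨m, hm⟩ := hdet
  have hN' : (N : ℂ) ≠ 0 := by exact_mod_cast hN.ne'
  -- Determinant one forces the trace of `X` to be `2πim = Nc`. Subtracting `c • 1` removes it; the
  -- lost factor `e^c` is restored by `c • 1 + E`, where `E` has trace `-Nc` but exponential `1`.
  set c : ℂ := m * (2 * Real.pi * Complex.I) / N with hc
  have hcconj : star c = -c := by
    simp [hc, neg_div]
  let E : Matrix (Fin N) (Fin N) ℂ := diagonal (Pi.single ⟨0, hN⟩ (-(N * c)))
  have hE : exp E = 1 := by
    rw [Matrix.exp_diagonal, ← diagonal_one]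
    congr 1
    ext i
    rw [Pi.coe_exp, ← Complex.exp_eq_exp_ℂ]
    by_cases hi : i = ⟨0, hN⟩
    · rw [hi, Pi.single_eq_same, hc, mul_div_cancel₀ _ hN', Complex.exp_neg,
        Complex.exp_int_mul_two_pi_mul_I, inv_one]
    · rw [Pi.single_eq_of_ne hi, Complex.exp_zero]
  have hscal : c • (1 : Matrix (Fin N) (Fin N) ℂ) ∈ uLie N := by
    rw [mem_uLie, conjTranspose_smul, conjTranspose_one, hcconj, neg_smul]
  have hEu : E ∈ uLie N := by
    refine (diagonal_conjTranspose _).trans ((congrArg diagonal ?_).trans (diagonal_neg _).symm)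
    rw [← Pi.single_star, star_neg, star_mul', hcconj]
    ext i
    by_cases hi : i = ⟨0, hN⟩
    · simp [hi]
    · simp [Pi.single_eq_of_ne hi]
  refine ⟨-(c • 1) + X, ⟨add_mem (neg_mem hscal) hX, ?_⟩, c • 1 + E,
    ⟨add_mem hscal hEu, ?_⟩, ?_⟩
  · rw [trace_add, trace_neg, trace_smul, trace_one, hm]
    simp [hc]
    field_simp
    simp
  · rw [trace_add, trace_smul, trace_one, trace_diagonal]
    simp
    ring
  · rw [← neg_smul, exp_smul_one_add, exp_smul_one_add, hE, smul_mul_smul_comm, ← Complex.exp_add]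
    simp

end UnitaryExponential

/-! ### Covering a compact group by powers of a neighborhood -/

section CompactGroup

open NormedSpace Filter
open scoped Pointwise

variable {N : ℕ}

lemma isCompact_unitaryGroup :
    IsCompact (unitaryGroup (Fin N) ℂ : Set (Matrix (Fin N) (Fin N) ℂ)) := by
  have hb : IsCompact (Set.univ.pi fun _ : Fin N => Set.univ.pi fun _ : Fin N =>
      Metric.closedBall (0 : ℂ) 1) :=
    isCompact_univ_pi fun _ => isCompact_univ_pi fun _ => isCompact_closedBall _ _
  refine IsCompact.of_isClosed_subset hb (isClosed_unitary (R := Matrix (Fin N) (Fin N) ℂ))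
    fun g hg i _ j _ => ?_
  rw [mem_closedBall_zero_iff]
  exact entry_norm_bound_of_unitary hg i j

lemma isCompact_specialUnitaryGroup :
    IsCompact (specialUnitaryGroup (Fin N) ℂ : Set (Matrix (Fin N) (Fin N) ℂ)) := by
  have : (specialUnitaryGroup (Fin N) ℂ : Set (Matrix (Fin N) (Fin N) ℂ)) =
      (unitaryGroup (Fin N) ℂ : Set (Matrix (Fin N) (Fin N) ℂ)) ∩ {A | A.det = 1} := by
    ext; exact mem_specialUnitaryGroup_iff
  rw [this]
  exact isCompact_unitaryGroup.inter_right
    (isClosed_eq (Continuous.matrix_det continuous_id) continuous_const)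

/-- Recurrence in a compact group: `g` is a cluster point of the positive powers of its inverse.
This replaces inverses, which would need backward time. -/
lemma exists_pow_star_mem_nhds {g : Matrix (Fin N) (Fin N) ℂ} (hg : g ∈ unitaryGroup (Fin N) ℂ)
    {W : Set (Matrix (Fin N) (Fin N) ℂ)} (hW : W ∈ 𝓝 g) : ∃ n : ℕ, star g ^ n ∈ W := by
  have : CompactSpace (unitary (Matrix (Fin N) (Fin N) ℂ)) :=
    isCompact_iff_compactSpace.1 isCompact_unitaryGroup
  let x : unitary (Matrix (Fin N) (Fin N) ℂ) := ⟨g, hg⟩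
  have h := mapClusterPt_self_zpow_atTop_pow x⁻¹ (-1)
  simp only [_root_.zpow_neg, _root_.zpow_one, inv_inv] at h
  have hW' : Subtype.val ⁻¹' W ∈ 𝓝 x := continuous_subtype_val.continuousAt.preimage_mem_nhds hW
  obtain ⟨n, hn⟩ := (h.frequently hW').exists
  exact ⟨n, by simpa using hn⟩

lemma eventually_exp_inv_smul_mem {W : Set (Matrix (Fin N) (Fin N) ℂ)} (hW : W ∈ 𝓝 1)
    (X : Matrix (Fin N) (Fin N) ℂ) : ∀ᶠ k : ℕ in atTop, exp ((k : ℝ)⁻¹ • X) ∈ W := by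
  have hc : Tendsto (fun t : ℝ => exp (t • X)) (𝓝 0) (𝓝 1) := by
    open scoped Matrix.Norms.Operator in
    have := (contDiff_exp_real (𝔸 := Matrix (Fin N) (Fin N) ℂ) (n := 0)).continuous.comp
      (continuous_id.smul continuous_const : Continuous fun t : ℝ => t • X)
    have := this.tendsto 0
    simpa using! this
  exact (hc.comp tendsto_inv_atTop_nhds_zero_nat) hW

lemma exp_inv_smul_pow (X : Matrix (Fin N) (Fin N) ℂ) {k : ℕ} (hk : k ≠ 0) :
    exp ((k : ℝ)⁻¹ • X) ^ k = exp X := by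
  rw [← Matrix.exp_nsmul, ← Nat.cast_smul_eq_nsmul ℝ, smul_smul,
    mul_inv_cancel₀ (by exact_mod_cast hk), one_smul]

variable {G : Submonoid (Matrix (Fin N) (Fin N) ℂ)} {S : Set (Matrix (Fin N) (Fin N) ℂ)}

/-- A compact matrix group in which all elements are products of two exponentials is covered by a
power of each neighborhood of the identity. -/
lemma exists_subset_pow_of_nhds_one (hG : G ≤ unitaryGroup (Fin N) ℂ)
    (hcpt : IsCompact (G : Set (Matrix (Fin N) (Fin N) ℂ))) (hstar : ∀ g ∈ G, star g ∈ G)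
    (hS : ∀ X ∈ S, ∀ t : ℝ, exp (t • X) ∈ G) (hexp : ∀ g ∈ G, ∃ X ∈ S, ∃ Y ∈ S, exp X * exp Y = g)
    {W : Set (Matrix (Fin N) (Fin N) ℂ)} (hW : W ∈ 𝓝 1) :
    ∃ k : ℕ, (G : Set (Matrix (Fin N) (Fin N) ℂ)) ⊆ (W ∩ G) ^ k := by
  have h1 : (1 : Matrix (Fin N) (Fin N) ℂ) ∈ W ∩ G := ⟨mem_of_mem_nhds hW, one_mem G⟩
  suffices ∃ k : ℕ, (G : Set (Matrix (Fin N) (Fin N) ℂ)) ∩ G ⊆ (W ∩ G) ^ k by simpa using this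
  refine hcpt.induction_on (p := fun s => ∃ k : ℕ, s ∩ G ⊆ (W ∩ G) ^ k) ⟨0, by simp⟩
    (fun s t hst ⟨k, hk⟩ => ⟨k, (Set.inter_subset_inter_left _ hst).trans hk⟩) ?_ ?_
  · rintro s t ⟨k, hk⟩ ⟨m, hm⟩
    refine ⟨max k m, ?_⟩
    rw [Set.union_inter_distrib_right]
    exact Set.union_subset (hk.trans (Set.pow_subset_pow_right h1 (le_max_left _ _)))
      (hm.trans (Set.pow_subset_pow_right h1 (le_max_right _ _)))
  · intro g hg
    obtain ⟨X, hX, Y, hY, rfl⟩ := hexp g hg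
    obtain ⟨k, ⟨hkX, hkY⟩, hk⟩ := (((eventually_exp_inv_smul_mem hW X).and
      (eventually_exp_inv_smul_mem hW Y)).and (eventually_ne_atTop 0)).exists
    have hgk : exp X * exp Y ∈ (W ∩ G) ^ (k + k) := by
      rw [pow_add, ← exp_inv_smul_pow X hk, ← exp_inv_smul_pow Y hk]
      exact Set.mul_mem_mul (Set.pow_mem_pow ⟨hkX, hS X hX _⟩) (Set.pow_mem_pow ⟨hkY, hS Y hY _⟩)
    set g := exp X * exp Y
    have hgg : g * star g = 1 := (mem_unitaryGroup_iff.1 (hG hg))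
    have hgg' : star g * g = 1 := (mem_unitaryGroup_iff'.1 (hG hg))
    -- Write `x = (x * star g) * g`: one factor from `W`, then `k + k` for the roots of the two
    -- exponentials.
    refine ⟨{x | x * star g ∈ W}, mem_nhdsWithin_of_mem_nhds ?_, 1 + (k + k), ?_⟩
    · have : ContinuousAt (fun x => x * star g) g := by fun_prop
      refine this.preimage_mem_nhds ?_
      rwa [hgg]
    · rintro x ⟨hx, hxG⟩
      rw [pow_add, pow_one]
      refine ⟨x * star g, ⟨hx, mul_mem hxG (hstar g hg)⟩, g, hgk, ?_⟩
      simp only [mul_assoc, hgg', mul_one]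

/-- A compact matrix group in which all elements are products of two exponentials is covered by a
power of each set with nonempty interior. -/
theorem exists_subset_pow_of_nhds (hG : G ≤ unitaryGroup (Fin N) ℂ)
    (hcpt : IsCompact (G : Set (Matrix (Fin N) (Fin N) ℂ))) (hstar : ∀ g ∈ G, star g ∈ G)
    (hS : ∀ X ∈ S, ∀ t : ℝ, exp (t • X) ∈ G) (hexp : ∀ g ∈ G, ∃ X ∈ S, ∃ Y ∈ S, exp X * exp Y = g)
    {g : Matrix (Fin N) (Fin N) ℂ} (hg : g ∈ G)
    {W : Set (Matrix (Fin N) (Fin N) ℂ)} (hW : W ∈ 𝓝 g) :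
    ∃ k : ℕ, (G : Set (Matrix (Fin N) (Fin N) ℂ)) ⊆ (W ∩ G) ^ k := by
  obtain ⟨n, hn⟩ := exists_pow_star_mem_nhds (hG hg) (interior_mem_nhds.2 hW)
  have hW' : {x | x * star g ^ n ∈ W} ∈ 𝓝 (1 : Matrix (Fin N) (Fin N) ℂ) := by
    have : ContinuousAt (fun x => x * star g ^ n) 1 := by fun_prop
    refine this.preimage_mem_nhds ?_
    rw [one_mul]
    exact mem_interior_iff_mem_nhds.1 hn
  obtain ⟨k, hk⟩ := exists_subset_pow_of_nhds_one hG hcpt hstar hS hexp hW'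
  -- Each `x` near `1` is `(x * star g ^ n) * g ^ n`, a product of `1 + n` elements of `W ∩ G`.
  refine ⟨(1 + n) * k, hk.trans ?_⟩
  rw [pow_mul]
  refine Set.pow_subset_pow_left ?_
  rintro x ⟨hx, hxG⟩
  rw [pow_add, pow_one]
  refine ⟨x * star g ^ n, ⟨hx, mul_mem hxG (pow_mem (hstar g hg) n)⟩, g ^ n,
    Set.pow_mem_pow ⟨mem_of_mem_nhds hW, hg⟩, ?_⟩
  have hgg' : star g ^ n * g ^ n = 1 := by
    rw [← (show Commute (star g) g from
      (mem_unitaryGroup_iff'.1 (hG hg)).trans (mem_unitaryGroup_iff.1 (hG hg)).symm).mul_pow,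
      mem_unitaryGroup_iff'.1 (hG hg), one_pow]
  simp only [mul_assoc, hgg', mul_one]

end CompactGroup

/-! ### Local transversals to the unitary and special unitary groups -/

section Transversals

open Filter
open scoped Matrix.Norms.Operator

/-- The equation reads `(2 + h) * h = 0`, and `2 + h` is a unit near zero. A Hermitian unitary
matrix squares to `1`, so near the identity it is the identity. -/
lemma eventually_eq_zero_of_one_add_mul_self {𝔸 : Type*} [NormedRing 𝔸] [NormedAlgebra ℝ 𝔸]
    [CompleteSpace 𝔸] : ∀ᶠ h in 𝓝 (0 : 𝔸), (1 + h) * (1 + h) = 1 → h = 0 := by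
  have h2 : IsUnit (2 + 0 : 𝔸) := by
    have := (IsUnit.mk0 (2 : ℝ) two_ne_zero).map (algebraMap ℝ 𝔸)
    rwa [map_ofNat, ← add_zero (2 : 𝔸)] at this
  have hev : ∀ᶠ h in 𝓝 (0 : 𝔸), IsUnit (2 + h) :=
    (by fun_prop : ContinuousAt (fun h : 𝔸 => 2 + h) 0).eventually
      (Units.isOpen.mem_nhds h2)
  filter_upwards [hev] with h hu hh
  refine hu.mul_left_cancel ?_
  rw [mul_zero]
  have : (2 + h) * h = (1 + h) * (1 + h) - 1 := by noncomm_ring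
  rw [this, hh, sub_self]

variable {N : ℕ}

/-- The real subspace of Hermitian matrices. -/
noncomputable abbrev hermitianSubmodule (N : ℕ) : Submodule ℝ (Matrix (Fin N) (Fin N) ℂ) :=
  selfAdjoint.submodule ℝ (Matrix (Fin N) (Fin N) ℂ)

lemma exists_eq_add_hermitian (A : Matrix (Fin N) (Fin N) ℂ) :
    ∃ X ∈ uLie N, ∃ Y ∈ hermitianSubmodule N, X + Y = A := by
  refine ⟨(2 : ℝ)⁻¹ • (A - star A), (uLie N).smul_mem _ ?_, (2 : ℝ)⁻¹ • (A + star A),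
    Submodule.smul_mem _ _ ?_, ?_⟩
  · rw [mem_uLie, ← star_eq_conjTranspose, star_sub, star_star, neg_sub]
  · exact IsSelfAdjoint.add_star_self A
  · rw [← smul_add, sub_add_add_cancel, ← two_smul ℝ A, smul_smul]
    norm_num

/-- A local transversal to a matrix group `G` with Lie algebra `L`. -/
def HasTransversal (L : Submodule ℝ (Matrix (Fin N) (Fin N) ℂ))
    (G : Set (Matrix (Fin N) (Fin N) ℂ)) : Prop :=
  ∃ (K : Type) (_ : NormedAddCommGroup K) (_ : NormedSpace ℝ K) (_ : CompleteSpace K)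
    (κ : K → Matrix (Fin N) (Fin N) ℂ) (κ' : K →L[ℝ] Matrix (Fin N) (Fin N) ℂ),
    HasStrictFDerivAt κ κ' 0 ∧ κ 0 = 1 ∧ L ⊔ LinearMap.range κ'.toLinearMap = ⊤ ∧
      ∀ᶠ y in 𝓝 0, κ y ∈ G → κ y = 1

lemma hasTransversal_unitaryGroup :
    HasTransversal (uLie N).toSubmodule (unitaryGroup (Fin N) ℂ) := by
  refine ⟨hermitianSubmodule N, inferInstance, inferInstance,
    FiniteDimensional.complete ℝ _, fun h => 1 + h.1,
    (hermitianSubmodule N).subtypeL, (hermitianSubmodule N).subtypeL.hasStrictFDerivAt.const_add 1,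
    by simp, ?_, ?_⟩
  · refine eq_top_iff.2 fun A _ => ?_
    obtain ⟨X, hX, Y, hY, rfl⟩ := exists_eq_add_hermitian A
    exact Submodule.add_mem_sup hX ⟨⟨Y, hY⟩, rfl⟩
  · have := (continuous_subtype_val (p := (· ∈ hermitianSubmodule N))).tendsto 0
    filter_upwards [this.eventually eventually_eq_zero_of_one_add_mul_self] with h hh hG
    have hstar : star (1 + h.1) = 1 + h.1 := by
      rw [star_add, star_one, h.2.star_eq]
    have := (mem_unitaryGroup_iff.1 hG)
    rw [hstar] at this
    rw [hh this, add_zero]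

/-- Besides the Hermitian directions, the scalar direction `i · 1` is normal, hence the extra phase.
Unitarity kills the Hermitian part; the determinant then gives `e^{iNθ} = 1`, and `|Nθ| < 2π` leaves
`Nθ = 0`. -/
lemma hasTransversal_specialUnitaryGroup :
    HasTransversal (suLie N).toSubmodule (specialUnitaryGroup (Fin N) ℂ) := by
  let κ' : hermitianSubmodule N × ℝ →L[ℝ] Matrix (Fin N) (Fin N) ℂ :=
    ((hermitianSubmodule N).subtypeL.comp (ContinuousLinearMap.fst ℝ _ _)) +
      (ContinuousLinearMap.snd ℝ _ _).smulRight (Complex.I • 1)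
  have hκ' : ∀ y, κ' y = y.1.1 + y.2 • Complex.I • (1 : Matrix (Fin N) (Fin N) ℂ) := fun _ => rfl
  have hexp : HasStrictDerivAt (fun θ : ℝ => Complex.exp (θ * Complex.I)) Complex.I 0 := by
    have := (Complex.ofRealCLM.hasStrictDerivAt (x := 0)).mul_const Complex.I
    simpa using HasStrictDerivAt.cexp this
  refine ⟨hermitianSubmodule N × ℝ, inferInstance, inferInstance, FiniteDimensional.complete ℝ _,
    fun y => Complex.exp (y.2 * Complex.I) • (1 + y.1.1), κ', ?_, by simp, ?_, ?_⟩
  · have h1 : HasStrictFDerivAt (fun y : hermitianSubmodule N × ℝ => Complex.exp (y.2 * Complex.I))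
        _ 0 :=
      HasStrictFDerivAt.comp (f := Prod.snd) (0 : hermitianSubmodule N × ℝ)
        hexp.hasStrictFDerivAt hasStrictFDerivAt_snd
    have h2 := ((hermitianSubmodule N).subtypeL.comp
      (ContinuousLinearMap.fst ℝ _ ℝ)).hasStrictFDerivAt.const_add 1 (x := 0)
    refine HasStrictFDerivAt.congr_fderiv (h1.smul h2) ?_
    refine ContinuousLinearMap.ext fun y => ?_
    refine Eq.trans ?_ (hκ' y).symm
    change Complex.exp (((0 : ℝ) : ℂ) * Complex.I) • y.1.1 +
      (y.2 • Complex.I) • ((1 : Matrix (Fin N) (Fin N) ℂ) + 0) = _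
    rw [Complex.ofReal_zero, zero_mul, Complex.exp_zero, one_smul, add_zero, smul_assoc]
  · refine eq_top_iff.2 fun A _ => ?_
    obtain ⟨X, hX, Y, hY, rfl⟩ := exists_eq_add_hermitian A
    have htr : X.trace = (X.trace.im : ℂ) * Complex.I := by
      have := congrArg trace (mem_uLie.1 hX)
      rw [trace_conjTranspose, trace_neg] at this
      refine Complex.ext ?_ (by simp)
      have := congrArg Complex.re this
      simp at this ⊢
      linarith
    let Z : Matrix (Fin N) (Fin N) ℂ := (X.trace.im / N : ℝ) • Complex.I • 1
    have hZ : Z ∈ uLie N :=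
      (uLie N).smul_mem _ (I_smul_mem_uLie isHermitian_one)
    have hXZ : X - Z ∈ suLie N := by
      refine ⟨sub_mem hX hZ, ?_⟩
      rcases Nat.eq_zero_or_pos N with rfl | hN
      · simp
      have hN' : (N : ℂ) ≠ 0 := by exact_mod_cast hN.ne'
      rw [trace_sub, trace_smul, trace_smul, trace_one, Fintype.card_fin, htr]
      simp
      field_simp
      simp
    have hsplit : X + Y = (X - Z) + κ' (⟨Y, hY⟩, X.trace.im / N) := by
      rw [hκ']
      simp only [Z]
      abel
    rw [hsplit]
    exact Submodule.add_mem_sup hXZ ⟨_, rfl⟩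
  · have h1 : Tendsto (fun y : hermitianSubmodule N × ℝ => y.1.1) (𝓝 0) (𝓝 0) :=
      (continuous_subtype_val.comp continuous_fst).tendsto _
    have h2 : ∀ᶠ y : hermitianSubmodule N × ℝ in 𝓝 0, |N * y.2| < 2 * Real.pi := by
      refine (by fun_prop : ContinuousAt (fun y : hermitianSubmodule N × ℝ => |N * y.2|) 0).eventually
        (gt_mem_nhds ?_)
      simp [Real.pi_pos]
    filter_upwards [h1.eventually eventually_eq_zero_of_one_add_mul_self, h2] with h hh hθ hG
    obtain ⟨hU, hdet⟩ := mem_specialUnitaryGroup_iff.1 hG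
    have hstar : star (1 + h.1.1) = 1 + h.1.1 := by
      rw [star_add, star_one, h.1.2.star_eq]
    have hone := mem_unitaryGroup_iff.1 (exp_mul_I_smul_mem_unitaryGroup (-h.2) hU)
    rw [smul_smul, ← Complex.exp_add] at hone
    simp only [Complex.ofReal_neg, neg_mul, neg_add_cancel, Complex.exp_zero, one_smul, hstar] at hone
    have h0 := hh hone
    rw [h0, add_zero] at hdet ⊢
    rw [det_smul, det_one, mul_one, Fintype.card_fin, ← Complex.exp_nat_mul,
      Complex.exp_eq_one_iff] at hdet
    obtain ⟨m, hm⟩ := hdet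
    have hm' : (N : ℝ) * h.2 = m * (2 * Real.pi) := by
      have : ((N * h.2 : ℝ) : ℂ) * Complex.I = ((m * (2 * Real.pi) : ℝ) : ℂ) * Complex.I := by
        push_cast; linear_combination hm
      exact_mod_cast mul_right_cancel₀ Complex.I_ne_zero this
    have hm0 : m = 0 := by
      rw [hm', abs_mul, abs_of_pos Real.two_pi_pos] at hθ
      have : |(m : ℝ)| < 1 := by
        by_contra! hle
        nlinarith [Real.two_pi_pos]
      rw [← Int.cast_abs] at this
      exact Int.abs_lt_one_iff.1 (by exact_mod_cast this)
    rw [hm0, Int.cast_zero, zero_mul] at hm'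
    -- For `N = 0` the phase is not determined, but all matrices coincide.
    rcases mul_eq_zero.1 hm' with hN | hθ0
    · have : N = 0 := by exact_mod_cast hN
      subst this
      exact Subsingleton.elim _ _
    · simp [hθ0]

end Transversals

/-! ### From rank conditions to robust global controllability -/

section Controllability

open NormedSpace Filter
open scoped Pointwise

section LieWords

variable {R : Type*} [Ring R]

/-- Membership and stability under the adjoint action must be carried together in the induction; the
Jacobi identity gives the second for brackets. -/
lemma IsLieWord.mem_and_lie_mem [Algebra ℝ R] {U : Submodule ℝ R} {x y z : R}
    (h : IsLieWord x y z) (hx : x ∈ U) (hy : y ∈ U)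
    (hU : ∀ u ∈ U, ⁅x, u⁆ ∈ U ∧ ⁅y, u⁆ ∈ U) : z ∈ U ∧ ∀ u ∈ U, ⁅z, u⁆ ∈ U := by
  induction h with
  | left => exact ⟨hx, fun u hu => (hU u hu).1⟩
  | right => exact ⟨hy, fun u hu => (hU u hu).2⟩
  | bracket _ _ ih₁ ih₂ =>
    refine ⟨ih₁.2 _ ih₂.1, fun u hu => ?_⟩
    rw [lie_lie]
    exact sub_mem (ih₁.2 _ (ih₂.2 u hu)) (ih₂.2 _ (ih₁.2 u hu))

lemma IsLieWord.exists_lift {x y z : R} (a b : ℝ) (h : IsLieWord x y z) :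
    ∃ r : ℝ, IsLieWord (x, a) (y, b) (z, r) := by
  induction h with
  | left => exact ⟨a, .left⟩
  | right => exact ⟨b, .right⟩
  | @bracket X Y _ _ ih₁ ih₂ =>
    obtain ⟨r, hr⟩ := ih₁
    obtain ⟨t, ht⟩ := ih₂
    exact ⟨_, .bracket hr ht⟩

/-- The clock coordinate lives in a commutative ring, so every commutator has clock component zero.
-/
lemma IsLieWord.lie_lift {x y z z' : R} (a b : ℝ) (h : IsLieWord x y z) (h' : IsLieWord x y z') :
    IsLieWord (x, a) (y, b) (⁅z, z'⁆, (0 : ℝ)) := by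
  obtain ⟨r, hr⟩ := h.exists_lift a b
  obtain ⟨t, ht⟩ := h'.exists_lift a b
  have := IsLieWord.bracket hr ht
  have h0 : ⁅(z, r), (z', t)⁆ = (⁅z, z'⁆, (0 : ℝ)) := by
    simp [Ring.lie_def, mul_comm]
  rwa [h0] at this

end LieWords

variable {N : ℕ}

lemma neg_lie_mem_iff {R : Type*} [Ring R] [Algebra ℝ R] {U : Submodule ℝ R} {x y : R} :
    ⁅-x, y⁆ ∈ U ↔ ⁅x, y⁆ ∈ U := by
  rw [neg_lie, neg_mem_iff]

/-- Under the rank condition, a subspace containing the generators which is invariant under their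
adjoint actions contains the Lie algebra. -/
lemma LieRankCondition.le {L : LieSubalgebra ℝ (Matrix (Fin N) (Fin N) ℂ)}
    {H₀ H₁ : Matrix (Fin N) (Fin N) ℂ} (h : LieRankCondition L H₀ H₁)
    {U : Submodule ℝ (Matrix (Fin N) (Fin N) ℂ)} (h0 : (generators H₀ H₁).1 ∈ U)
    (h1 : (generators H₀ H₁).2 ∈ U)
    (hU : ∀ u ∈ U, ⁅(generators H₀ H₁).1, u⁆ ∈ U ∧ ⁅(generators H₀ H₁).2, u⁆ ∈ U) :
    L.toSubmodule ≤ U := by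
  simp only [generators, neg_mem_iff, neg_lie_mem_iff] at h0 h1 hU
  rw [← h, Submodule.span_le]
  rintro Z (⟨X, Y, hX, hY, rfl⟩ | rfl | rfl)
  · exact ((hX.bracket hY).mem_and_lie_mem h0 h1 hU).1
  · exact h0
  · exact h1

/-- The system extended by the exponential of time. -/
def extendByTime {R : Type*} (s : R × R) : (R × ℝ) × (R × ℝ) := ((s.1, 1), (s.2, 0))

/-- Commutators and the control direction lift with clock component zero, so they can be used
without changing the total time. The drift lifts with a nonzero component, which is why it is left
out of this condition. -/
lemma ExactTimeLieRankCondition.le {L : LieSubalgebra ℝ (Matrix (Fin N) (Fin N) ℂ)}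
    {H₀ H₁ : Matrix (Fin N) (Fin N) ℂ} (h : ExactTimeLieRankCondition L H₀ H₁)
    {U : Submodule ℝ (Matrix (Fin N) (Fin N) ℂ × ℝ)}
    (h0 : (extendByTime (generators H₀ H₁)).1 ∈ U) (h1 : (extendByTime (generators H₀ H₁)).2 ∈ U)
    (hU : ∀ u ∈ U, ⁅(extendByTime (generators H₀ H₁)).1, u⁆ ∈ U ∧
      ⁅(extendByTime (generators H₀ H₁)).2, u⁆ ∈ U) :
    L.toSubmodule ≤ U.comap (LinearMap.inl ℝ (Matrix (Fin N) (Fin N) ℂ) ℝ) := by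
  have e1 : (extendByTime (generators H₀ H₁)).1 = -(Complex.I • H₀, -1) := by
    simp [extendByTime, generators]
  have e2 : (extendByTime (generators H₀ H₁)).2 = -(Complex.I • H₁, 0) := by
    simp [extendByTime, generators]
  simp only [e1, e2, neg_mem_iff, neg_lie_mem_iff] at h0 h1 hU
  rw [← h, Submodule.span_le]
  rintro Z (⟨X, Y, hX, hY, rfl⟩ | rfl)
  · exact ((hX.lie_lift (-1) 0 hY).mem_and_lie_mem h0 h1 hU).1
  · exact h1

lemma endpoint_extendByTime {𝔸 : Type*} [NormedRing 𝔸] [NormedAlgebra ℝ 𝔸] [CompleteSpace 𝔸]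
    (s : 𝔸 × 𝔸) (w : List (ℝ × ℝ)) :
    endpoint (extendByTime s) w = (endpoint s w, Real.exp (duration w)) := by
  let +nondep : NormedAlgebra ℚ 𝔸 := .restrictScalars ℚ ℝ 𝔸
  induction w with
  | nil => simp [endpoint, duration_nil, Prod.one_eq_mk]
  | cons l w ih =>
    rw [endpoint, ih, endpoint, duration_cons, Real.exp_add, Real.exp_eq_exp_ℝ]
    refine Prod.ext ?_ ?_
    · simp [extendByTime, Prod.fst_exp]
    · simp [extendByTime, Prod.snd_exp]

open scoped Matrix.Norms.Operator

/-- The properties of the pairs `(𝔲(N), U(N))` and `(𝔰𝔲(N), SU(N))` on which controllability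
rests. -/
structure IsCompactLiePair (L : LieSubalgebra ℝ (Matrix (Fin N) (Fin N) ℂ))
    (G : Submonoid (Matrix (Fin N) (Fin N) ℂ)) : Prop where
  le_unitaryGroup : G ≤ unitaryGroup (Fin N) ℂ
  isCompact : IsCompact (G : Set (Matrix (Fin N) (Fin N) ℂ))
  star_mem : ∀ g ∈ G, star g ∈ G
  exp_mem : ∀ X ∈ L, exp X ∈ G
  exists_exp_mul_exp_eq : ∀ g ∈ G, ∃ X ∈ L, ∃ Y ∈ L, exp X * exp Y = g
  hasTransversal : HasTransversal L.toSubmodule G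

lemma isCompactLiePair_unitary : IsCompactLiePair (uLie N) (unitaryGroup (Fin N) ℂ) where
  le_unitaryGroup := le_rfl
  isCompact := isCompact_unitaryGroup
  star_mem := fun _ hg => Unitary.star_mem hg
  exp_mem := fun _ => exp_mem_unitaryGroup
  exists_exp_mul_exp_eq := fun g hg => by
    obtain ⟨X, hX, rfl⟩ := exists_exp_eq_of_mem_unitaryGroup hg
    exact ⟨X, hX, 0, zero_mem _, by rw [exp_zero, mul_one]⟩
  hasTransversal := hasTransversal_unitaryGroup

lemma isCompactLiePair_specialUnitary :
    IsCompactLiePair (suLie N) (specialUnitaryGroup (Fin N) ℂ) where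
  le_unitaryGroup := specialUnitaryGroup_le_unitaryGroup
  isCompact := isCompact_specialUnitaryGroup
  star_mem := fun g hg => (star (⟨g, hg⟩ : specialUnitaryGroup (Fin N) ℂ)).2
  exp_mem := fun _ => exp_mem_specialUnitaryGroup
  exists_exp_mul_exp_eq := fun _ => exists_exp_mul_exp_eq_of_mem_specialUnitaryGroup
  hasTransversal := hasTransversal_specialUnitaryGroup

variable {L : LieSubalgebra ℝ (Matrix (Fin N) (Fin N) ℂ)}
  {G : Submonoid (Matrix (Fin N) (Fin N) ℂ)}
  {s : Matrix (Fin N) (Fin N) ℂ × Matrix (Fin N) (Fin N) ℂ}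

lemma IsCompactLiePair.endpoint_mem (h : IsCompactLiePair L G) (h1 : s.1 ∈ L) (h2 : s.2 ∈ L)
    (w : List (ℝ × ℝ)) : endpoint s w ∈ G := by
  induction w with
  | nil => exact one_mem G
  | cons l w ih => exact mul_mem (h.exp_mem _ (L.smul_mem _ (add_mem h1 (L.smul_mem _ h2)))) ih

lemma IsCompactLiePair.mul_star (h : IsCompactLiePair L G) {g : Matrix (Fin N) (Fin N) ℂ}
    (hg : g ∈ G) : g * star g = 1 := mem_unitaryGroup_iff.1 (h.le_unitaryGroup hg)

lemma IsCompactLiePair.star_mul (h : IsCompactLiePair L G) {g : Matrix (Fin N) (Fin N) ℂ}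
    (hg : g ∈ G) : star g * g = 1 := mem_unitaryGroup_iff'.1 (h.le_unitaryGroup hg)

lemma IsCompactLiePair.mem_of_mul_mem (h : IsCompactLiePair L G)
    {x g : Matrix (Fin N) (Fin N) ℂ} (hg : g ∈ G) (hx : x * g ∈ G) : x ∈ G := by
  have := mul_mem hx (h.star_mem g hg)
  rwa [mul_assoc, h.mul_star hg, mul_one] at this

lemma generators_mem {H₀ H₁ : Matrix (Fin N) (Fin N) ℂ} (h0 : H₀ ∈ hamiltonians L)
    (h1 : H₁ ∈ hamiltonians L) : (generators H₀ H₁).1 ∈ L ∧ (generators H₀ H₁).2 ∈ L :=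
  ⟨neg_mem h0, neg_mem h1⟩

/-- Elements of `A` are endpoints of positive words with durations in `[lo, hi]`. -/
def CoveredInTime (s : Matrix (Fin N) (Fin N) ℂ × Matrix (Fin N) (Fin N) ℂ) (lo hi : ℝ)
    (A : Set (Matrix (Fin N) (Fin N) ℂ)) : Prop :=
  ∀ g ∈ A, ∃ w, IsPositiveWord w ∧ lo ≤ duration w ∧ duration w ≤ hi ∧ endpoint s w = g

lemma CoveredInTime.mul {lo hi lo' hi' : ℝ} {A B : Set (Matrix (Fin N) (Fin N) ℂ)}
    (hA : CoveredInTime s lo hi A) (hB : CoveredInTime s lo' hi' B) :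
    CoveredInTime s (lo + lo') (hi + hi') (A * B) := by
  rintro _ ⟨x, hx, y, hy, rfl⟩
  obtain ⟨w, hw, h1, h2, rfl⟩ := hA x hx
  obtain ⟨w', hw', h1', h2', rfl⟩ := hB y hy
  refine ⟨w ++ w', hw.append hw', ?_, ?_, endpoint_append s w w'⟩ <;> rw [duration_append] <;>
    linarith

lemma CoveredInTime.pow {lo hi : ℝ} {A : Set (Matrix (Fin N) (Fin N) ℂ)}
    (hA : CoveredInTime s lo hi A) (k : ℕ) : CoveredInTime s (k * lo) (k * hi) (A ^ k) := by
  induction k with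
  | zero =>
    rintro g hg
    rw [pow_zero, Set.mem_one] at hg
    exact ⟨[], isPositiveWord_nil, by simp [duration_nil], by simp [duration_nil], hg.symm⟩
  | succ k ih =>
    rw [pow_succ]
    convert ih.mul hA using 1 <;> push_cast <;> ring

/-- Waiting for a time `τ` under the drift. -/
lemma CoveredInTime.add (h : IsCompactLiePair L G) (h1 : s.1 ∈ L) (h2 : s.2 ∈ L) {lo hi τ : ℝ}
    (hG : CoveredInTime s lo hi G) (hτ : 0 < τ) : CoveredInTime s (lo + τ) (hi + τ) G := by
  have hx := h.endpoint_mem h1 h2 [(τ, 0)]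
  have hτ' : CoveredInTime s τ τ {endpoint s [(τ, 0)]} := by
    rintro g rfl
    exact ⟨_, isPositiveWord_cons.2 ⟨hτ, isPositiveWord_nil⟩, by simp [duration],
      by simp [duration], rfl⟩
  intro g hg
  -- The rightmost factor acts first: drift for time `τ`, then correct for the drift.
  refine (hG.mul hτ') g ⟨g * star (endpoint s [(τ, 0)]), mul_mem hg (h.star_mem _ hx), _, rfl, ?_⟩
  simp only [mul_assoc, h.star_mul hx, mul_one]

variable {H₀ H₁ : Matrix (Fin N) (Fin N) ℂ}

lemma LieRankCondition.exists_nhds_covered (hc : LieRankCondition L H₀ H₁)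
    (h : IsCompactLiePair L G) (h0 : H₀ ∈ hamiltonians L) (h1 : H₁ ∈ hamiltonians L) :
    ∃ D : ℝ, ∃ V ∈ 𝓝 (generators H₀ H₁), ∃ g ∈ G, ∃ W ∈ 𝓝 g, ∀ s ∈ V, s.1 ∈ L → s.2 ∈ L →
      CoveredInTime s 0 D (W ∩ G) := by
  obtain ⟨K, _, _, _, κ, κ', hκ, hκ1, htop, hev⟩ := h.hasTransversal
  obtain ⟨w, D, hw, hcov⟩ := exists_word_nhds_covered hκ hκ1 (generators H₀ H₁)
    (fun U hU1 hU2 hU => top_le_iff.1 (htop ▸ sup_le_sup_right (hc.le hU1 hU2 hU) _))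
  -- The admissible `y` are those for which `κ y ∈ G` forces `κ y = 1`.
  obtain ⟨V, hV, W, hW, hVW⟩ := hcov _ hev
  have hgen := generators_mem h0 h1
  refine ⟨D, V, hV, _, h.endpoint_mem hgen.1 hgen.2 w, W, hW, ?_⟩
  rintro s hs hs1 hs2 g ⟨hgW, hgG⟩
  obtain ⟨w', hw', hD, y, hy, rfl⟩ := hVW s hs g hgW
  have hy1 : κ y = 1 := hy (h.mem_of_mul_mem (h.endpoint_mem hs1 hs2 w') hgG)
  exact ⟨w', hw', hw'.duration_nonneg, hD, by rw [hy1, one_mul]⟩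

lemma ExactTimeLieRankCondition.exists_nhds_covered (hc : ExactTimeLieRankCondition L H₀ H₁)
    (h : IsCompactLiePair L G) (h0 : H₀ ∈ hamiltonians L) (h1 : H₁ ∈ hamiltonians L) :
    ∃ D : ℝ, 0 ≤ D ∧ ∃ V ∈ 𝓝 (generators H₀ H₁), ∃ g ∈ G, ∃ W ∈ 𝓝 g, ∀ s ∈ V,
      s.1 ∈ L → s.2 ∈ L → CoveredInTime s D D (W ∩ G) := by
  obtain ⟨K, _, _, _, κ, κ', hκ, hκ1, htop, hev⟩ := h.hasTransversal
  have hgen := generators_mem h0 h1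
  obtain ⟨w, D, hw, hcov⟩ := exists_word_nhds_covered
    -- The transversal is constantly `1` in the clock coordinate, so it cannot alter the recorded
    -- time.
    (hκ.prodMk (hasStrictFDerivAt_const (1 : ℝ) (0 : K)))
    (by rw [hκ1]; rfl) (extendByTime (generators H₀ H₁)) (fun U hU1 hU2 hU => by
      refine eq_top_iff.2 fun ⟨A, r⟩ _ => ?_
      -- A multiple of the extended drift accounts for the clock component `r`; the rest is handled
      -- in the matrix coordinate.
      obtain ⟨X, hX, _, ⟨k, rfl⟩, hXk⟩ := Submodule.mem_sup.1
        (htop ▸ Submodule.mem_top : A - r • (generators H₀ H₁).1 ∈ _)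
      have hXU : (X, (0 : ℝ)) ∈ U := hc.le hU1 hU2 hU hX
      have hsplit : (A, r) = ((X, (0 : ℝ)) + r • (extendByTime (generators H₀ H₁)).1) +
          (κ'.prod 0) k := by
        refine Prod.ext ?_ ?_
        · simp only [extendByTime, Prod.fst_add, Prod.smul_fst, ContinuousLinearMap.prod_apply]
          rw [add_right_comm]
          exact (sub_eq_iff_eq_add.1 hXk.symm)
        · simp [extendByTime]
      rw [hsplit]
      exact Submodule.add_mem_sup (add_mem hXU (U.smul_mem r hU1)) ⟨k, rfl⟩)
  obtain ⟨V, hV, W, hW, hVW⟩ := hcov _ hev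
  rw [endpoint_extendByTime] at hW
  refine ⟨duration w, hw.duration_nonneg, extendByTime ⁻¹' V, ?_, _,
    h.endpoint_mem hgen.1 hgen.2 w, (fun g => (g, Real.exp (duration w))) ⁻¹' W, ?_, ?_⟩
  · have : Continuous (extendByTime : Matrix (Fin N) (Fin N) ℂ × Matrix (Fin N) (Fin N) ℂ → _) := by
      unfold extendByTime
      fun_prop
    exact this.continuousAt.preimage_mem_nhds hV
  · have : Continuous fun g : Matrix (Fin N) (Fin N) ℂ => (g, Real.exp (duration w)) := by
      fun_prop
    exact this.continuousAt.preimage_mem_nhds hW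
  rintro s hs hs1 hs2 g ⟨hgW, hgG⟩
  obtain ⟨w', hw', -, y, hy, hyg⟩ := hVW _ hs _ hgW
  rw [endpoint_extendByTime, Prod.mk_mul_mk, one_mul, Prod.mk.injEq] at hyg
  obtain ⟨rfl, hT⟩ := hyg
  have hy1 : κ y = 1 := hy (h.mem_of_mul_mem (h.endpoint_mem hs1 hs2 w') hgG)
  exact ⟨w', hw', (Real.exp_injective hT).ge, (Real.exp_injective hT).le, by rw [hy1, one_mul]⟩

/-- A neighborhood in the group covered in bounded time yields the group in bounded time. -/
lemma IsCompactLiePair.exists_coveredInTime (h : IsCompactLiePair L G)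
    {g : Matrix (Fin N) (Fin N) ℂ} (hg : g ∈ G) {W : Set (Matrix (Fin N) (Fin N) ℂ)}
    (hW : W ∈ 𝓝 g) : ∃ k : ℕ, ∀ s lo hi, CoveredInTime s lo hi (W ∩ G) →
      CoveredInTime s (k * lo) (k * hi) (G : Set (Matrix (Fin N) (Fin N) ℂ)) := by
  obtain ⟨k, hk⟩ := exists_subset_pow_of_nhds h.le_unitaryGroup h.isCompact h.star_mem
    (fun X hX t => h.exp_mem _ (L.smul_mem t hX)) h.exists_exp_mul_exp_eq hg hW
  exact ⟨k, fun s lo hi hs x hx => hs.pow k x (hk hx)⟩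

lemma continuous_generators_hamiltonians (L : LieSubalgebra ℝ (Matrix (Fin N) (Fin N) ℂ)) :
    Continuous fun H : hamiltonians L × hamiltonians L =>
      generators (H.1 : Matrix (Fin N) (Fin N) ℂ) H.2 := by
  unfold generators
  fun_prop

theorem LieRankCondition.exists_nhds_reaches (h : IsCompactLiePair L G)
    {H : hamiltonians L × hamiltonians L}
    (hc : LieRankCondition L (H.1 : Matrix (Fin N) (Fin N) ℂ) H.2) :
    ∃ Tmax : ℝ, 0 < Tmax ∧ ∃ V ∈ 𝓝 H, ∀ s ∈ V, ∀ g ∈ G,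
      ∃ T : ℝ, T < Tmax ∧ Reaches (s.1 : Matrix (Fin N) (Fin N) ℂ) s.2 T g := by
  obtain ⟨D, V, hV, g₀, hg₀, W, hW, hcov⟩ := hc.exists_nhds_covered h H.1.2 H.2.2
  obtain ⟨k, hk⟩ := h.exists_coveredInTime hg₀ hW
  -- The sign of `D` is not known here. A unit of waiting makes the duration positive, and the
  -- second unit makes the bound strict.
  refine ⟨|k * D| + 2, by positivity, _,
    (continuous_generators_hamiltonians L).continuousAt.preimage_mem_nhds hV, fun s hs g hg => ?_⟩
  have hgen := generators_mem s.1.2 s.2.2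
  obtain ⟨w, hw, hlo, hhi, rfl⟩ := (hk _ _ _ (hcov _ hs hgen.1 hgen.2)).add h hgen.1 hgen.2
    one_pos g hg
  exact ⟨_, by linarith [le_abs_self (k * D)], reaches_endpoint _ _ hw (by linarith)⟩

theorem ExactTimeLieRankCondition.exists_nhds_reaches (h : IsCompactLiePair L G)
    {H : hamiltonians L × hamiltonians L}
    (hc : ExactTimeLieRankCondition L (H.1 : Matrix (Fin N) (Fin N) ℂ) H.2) :
    ∃ Tc : ℝ, 0 ≤ Tc ∧ ∃ V ∈ 𝓝 H, ∀ s ∈ V, ∀ g ∈ G,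
      ∀ T : ℝ, Tc < T → Reaches (s.1 : Matrix (Fin N) (Fin N) ℂ) s.2 T g := by
  obtain ⟨D, hD, V, hV, g₀, hg₀, W, hW, hcov⟩ := hc.exists_nhds_covered h H.1.2 H.2.2
  obtain ⟨k, hk⟩ := h.exists_coveredInTime hg₀ hW
  refine ⟨k * D, by positivity, _,
    (continuous_generators_hamiltonians L).continuousAt.preimage_mem_nhds hV,
    fun s hs g hg T hT => ?_⟩
  have hgen := generators_mem s.1.2 s.2.2
  have hk0 : 0 ≤ k * D := by positivity
  obtain ⟨w, hw, hlo, hhi, rfl⟩ := (hk _ _ _ (hcov _ hs hgen.1 hgen.2)).add h hgen.1 hgen.2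
    (sub_pos.2 hT) g hg
  -- Both duration bounds equal `k * D + (T - k * D)`.
  obtain rfl : duration w = T := by linarith
  exact reaches_endpoint _ _ hw (by linarith)

end Controllability

theorem theorem1 (N : ℕ)
    (L : LieSubalgebra ℝ (Matrix (Fin N) (Fin N) ℂ))
    (G : Submonoid (Matrix (Fin N) (Fin N) ℂ))
    (hLG : (L = uLie N ∧ G = Matrix.unitaryGroup (Fin N) ℂ) ∨
      (L = suLie N ∧ G = Matrix.specialUnitaryGroup (Fin N) ℂ))
    (H : hamiltonians L × hamiltonians L) :
    (LieRankCondition L (H.1 : Matrix (Fin N) (Fin N) ℂ) H.2 →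
      ∃ Tmax : ℝ, 0 < Tmax ∧ ∃ V ∈ 𝓝 H, ∀ s ∈ V, ∀ g ∈ G,
        ∃ T : ℝ, T < Tmax ∧ Reaches (s.1 : Matrix (Fin N) (Fin N) ℂ) s.2 T g) ∧
    (ExactTimeLieRankCondition L (H.1 : Matrix (Fin N) (Fin N) ℂ) H.2 →
      ∃ Tc : ℝ, 0 ≤ Tc ∧ ∃ V ∈ 𝓝 H, ∀ s ∈ V, ∀ g ∈ G,
        ∀ T : ℝ, Tc < T → Reaches (s.1 : Matrix (Fin N) (Fin N) ℂ) s.2 T g) := by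
  have h : IsCompactLiePair L G := by
    rcases hLG with ⟨rfl, rfl⟩ | ⟨rfl, rfl⟩
    exacts [isCompactLiePair_unitary, isCompactLiePair_specialUnitary]
  exact ⟨fun hc => hc.exists_nhds_reaches h, fun hc => hc.exists_nhds_reaches h⟩
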